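/- Let $m,k\ge 1$ be integers, $n=mk$ and $p=1/m$. Throw $n$ balls one after the other, independently and uniformly at random, into $m$ bins of capacity $k$; a ball that is mapped to a full bin (one that already stores $k$ balls) is forwarded to the spare. Let $X$ be the number of balls forwarded to the spare; equivalently $X=\sum_{i=1}^m\max\{0,B_i-k\}$, where $B_i$ is the number of balls mapped to bin $i$. Let $\mathrm{Bin}(n,p)$ denote a binomial random variable with parameters $n$ and $p$. Then $$\mathbb{E}[X]=n(1-p)\Pr[\mathrm{Bin}(n,p)=k]\le \frac{n}{\sqrt{2\pi k}}.$$ If moreover $n\ge 5k$ and $k\ge 20$, then for every real $\delta>0$ $$\Pr\big[X\ge(1+\delta)\,\mathbb{E}[X]\big]\le\min\left\{\frac{2\pi k}{0.99\,\delta^2 n},\ \exp\left(-\frac{0.99\,\delta^2 m(1-p)}{\pi k}\right)\right\}.$$ -/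

import Mathlib

/-! Throwing balls, one after the other, into `m` bins of capacity `k`. -/

namespace BallsIntoBins

/-- State of the two-level table: how many balls each of the `m` bins currently stores, and how
many balls have been forwarded to the spare so far. -/
structure State (m : ℕ) where
  load : Fin m → ℕ
  spare : ℕ

/-- Throw one ball that is mapped to bin `b`: it is stored in bin `b` if that bin stores fewer than
`k` balls, and it is forwarded to the spare if bin `b` is full. -/
def throwBall {m : ℕ} (k : ℕ) (s : State m) (b : Fin m) : State m :=
  if s.load b < k then ⟨Function.update s.load b (s.load b + 1), s.spare⟩
  else ⟨s.load, s.spare + 1⟩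

/-- Throw the balls of a list of bin indices in order, starting with empty bins and an empty
spare. -/
def throwBalls {m : ℕ} (k : ℕ) (l : List (Fin m)) : State m :=
  l.foldl (throwBall k) ⟨fun _ => 0, 0⟩

/-- The number of balls forwarded to the spare when balls `0, …, n - 1` are thrown and
ball `j` is mapped to bin `h j`. -/
def numForwarded {n m : ℕ} (k : ℕ) (h : Fin n → Fin m) : ℕ :=
  (throwBalls k (List.ofFn h)).spare

/-- The number `B_i` of balls that are mapped to bin `i`. -/
def ballCount {n m : ℕ} (h : Fin n → Fin m) (i : Fin m) : ℕ :=
  (Finset.univ.filter fun j => h j = i).card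

theorem throwBalls_spec {m : ℕ} (k : ℕ) (l : List (Fin m)) :
    (∀ i, (throwBalls k l).load i = min k (l.count i)) ∧
      (throwBalls k l).spare = ∑ i, (l.count i - k) := by
  induction l using List.reverseRecOn with
  | nil => simp [throwBalls]
  | append_singleton l b ih =>
    obtain ⟨h1, h2⟩ := ih
    have e : throwBalls k (l ++ [b]) = throwBall k (throwBalls k l) b := by
      simp [throwBalls]
    have hc : ∀ i, (l ++ [b]).count i = l.count i + if i = b then 1 else 0 := by
      intro i
      rw [List.count_append, List.count_singleton]
      by_cases hi : i = b
      · simp [hi]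
      · simp [hi, Ne.symm hi]
    rw [e, throwBall]
    by_cases hb : (throwBalls k l).load b < k
    · rw [if_pos hb]
      rw [h1] at hb
      refine ⟨fun i => ?_, ?_⟩
      · rw [hc]
        by_cases hi : i = b
        · subst hi
          simp only [Function.update_self, if_true, h1]
          omega
        · simp [hi, h1]
      · simp only [h2]
        refine Finset.sum_congr rfl fun i _ => ?_
        rw [hc]
        by_cases hi : i = b
        · subst hi
          simp only [if_true]
          omega
        · simp [hi]
    · rw [if_neg hb]
      rw [h1] at hb
      refine ⟨fun i => ?_, ?_⟩
      · simp only [hc, h1]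
        by_cases hi : i = b
        · subst hi
          simp only [if_true]
          omega
        · simp [hi]
      · have : ∀ i, (l ++ [b]).count i - k = (l.count i - k) + if i = b then 1 else 0 := by
          intro i
          rw [hc]
          by_cases hi : i = b
          · subst hi
            simp only [if_true]
            omega
          · simp [hi]
        simp only [this, h2, Finset.sum_add_distrib]
        simp

/-- The number of forwarded balls is `∑ i, max (B_i - k) 0` (natural-number subtraction truncates
at `0`). -/
theorem numForwarded_eq_sum {n m : ℕ} (k : ℕ) (h : Fin n → Fin m) :
    numForwarded k h = ∑ i, (ballCount h i - k) := by
  rw [numForwarded, (throwBalls_spec k _).2]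
  refine Finset.sum_congr rfl fun i _ => ?_
  congr 1
  rw [ballCount, List.ofFn_eq_map, List.count, List.countP_map, List.countP_eq_length_filter,
    ← List.toFinset_card_of_nodup ((List.nodup_finRange n).filter _)]
  congr 1
  ext j
  simp

end BallsIntoBins

open MeasureTheory ProbabilityTheory

/-! Write `b j` for the binomial weights and `q = 1 - p`. Since `n * p = k`, the terms `(j - k) * b
j` telescope, so each bin has mean excess `k * q * b k`; summing over the `m` bins gives the
expectation. `stirlingSeq` decreases to `√π` from index 1 on. Writing `q * (b k) ^ 2` through it
gives the upper bound `1 / (2πk)`, hence the estimate of the mean, and the lower bound `1 / (4πk)`.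
Moving one ball changes `X` by at most 1, so McDiarmid gives the tail `exp (-2 (δ E[X])² / n)`. With
the lower bound on `q * (b k) ^ 2`, this single estimate implies both terms of the minimum. -/

/-! ### Mean excess and law of a binomial count -/

theorem Nat.cast_sub_mul_binomial_telescope (n j : ℕ) (p : ℝ) :
    ((j : ℝ) - n * p) * ((n.choose j : ℝ) * p ^ j * (1 - p) ^ (n - j)) =
      j * (1 - p) * ((n.choose j : ℝ) * p ^ j * (1 - p) ^ (n - j)) -
      (j + 1 : ℕ) * (1 - p) * ((n.choose (j + 1) : ℝ) * p ^ (j + 1) * (1 - p) ^ (n - (j + 1))) := by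
  rcases lt_trichotomy j n with hj | rfl | hj
  · have h1 : (n.choose (j + 1) : ℝ) * (j + 1 : ℕ) = n.choose j * (n - j) := by
      rw [← Nat.cast_sub hj.le]
      exact_mod_cast Nat.choose_succ_right_eq n j
    have h2 : (1 - p) ^ (n - j) = (1 - p) ^ (n - (j + 1)) * (1 - p) := by
      rw [← pow_succ]; congr 1; omega
    rw [h2]
    linear_combination (p ^ (j + 1) * (1 - p) ^ (n - (j + 1)) * (1 - p)) * h1
  · simp only [Nat.choose_succ_self, Nat.cast_zero]
    ring
  · simp [Nat.choose_eq_zero_of_lt hj, Nat.choose_eq_zero_of_lt (hj.trans (Nat.lt_succ_self j))]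

theorem ProbabilityTheory.integral_tsub_binomial (n k : ℕ) (p : unitInterval)
    (h : (n : ℝ) * p = k) :
    ∫ j, ((j - k : ℕ) : ℝ) ∂(binomial n p) = k * (1 - p) * (binomial n p).real {k} := by
  -- Terms below `k` vanish by truncation; from `k` on the sum telescopes. At `k + d = n + 1` the
  -- boundary term is zero because `n.choose (n + 1) = 0`.
  have key : ∀ d : ℕ, ∑ j ∈ Finset.range (k + d),
      ((n.choose j : ℝ) * (p : ℝ) ^ j * (1 - p) ^ (n - j)) * ((j - k : ℕ) : ℝ) =
      k * (1 - p) * ((n.choose k : ℝ) * (p : ℝ) ^ k * (1 - p) ^ (n - k)) -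
      (k + d : ℕ) * (1 - p) * ((n.choose (k + d) : ℝ) * (p : ℝ) ^ (k + d) *
        (1 - p) ^ (n - (k + d))) := by
    intro d
    induction d with
    | zero =>
      simp only [add_zero, sub_self]
      exact Finset.sum_eq_zero fun j hj => by
        simp [Nat.sub_eq_zero_of_le (Finset.mem_range.1 hj).le]
    | succ d ih =>
      rw [← add_assoc, Finset.sum_range_succ, ih]
      have := Nat.cast_sub_mul_binomial_telescope n (k + d) p
      rw [h] at this
      have h2 : ((k + d - k : ℕ) : ℝ) = ((k + d : ℕ) : ℝ) - k := by simp
      rw [h2]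
      linear_combination this
  have hkn : k ≤ n := by
    have : (k : ℝ) ≤ n := by
      rw [← h]
      exact mul_le_of_le_one_right n.cast_nonneg p.2.2
    exact_mod_cast this
  have hI : Finset.Iic n = Finset.range (k + (n + 1 - k)) := by
    ext j
    simp only [Finset.mem_Iic, Finset.mem_range]
    omega
  rw [integral_binomial, binomial_real_singleton, hI]
  simp only [smul_eq_mul]
  rw [key, show k + (n + 1 - k) = n + 1 by omega]
  simp

/-- The event splits disjointly by the exact set `S` of coordinates equal to `a`; each piece is a
box, so its measure is a product. -/
theorem MeasureTheory.Measure.pi_real_card_filter_eq {ι α : Type*} [Fintype ι]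
    [MeasurableSpace α] [MeasurableSingletonClass α] [DecidableEq α]
    (ν : Measure α) [IsProbabilityMeasure ν] (a : α) (k : ℕ) :
    (Measure.pi fun _ : ι => ν).real {x | (Finset.univ.filter fun j => x j = a).card = k} =
      ((Fintype.card ι).choose k : ℝ) * ν.real {a} ^ k *
        (1 - ν.real {a}) ^ (Fintype.card ι - k) := by
  classical
  let A : Finset ι → Set (ι → α) :=
    fun S => Set.pi Set.univ fun j => if j ∈ S then {a} else {a}ᶜ
  have memA : ∀ S x, x ∈ A S ↔ (Finset.univ.filter fun j => x j = a) = S := by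
    intro S x
    simp only [A, Set.mem_univ_pi, Finset.ext_iff, Finset.mem_filter, Finset.mem_univ, true_and]
    refine forall_congr' fun j => ?_
    by_cases hj : j ∈ S <;> simp [hj]
  have hU : {x : ι → α | (Finset.univ.filter fun j => x j = a).card = k} =
      ⋃ S ∈ Finset.powersetCard k (Finset.univ : Finset ι), A S := by
    ext x
    simp [memA, Finset.mem_powersetCard]
  have hmeas : ∀ S, MeasurableSet (A S) := fun S =>
    MeasurableSet.univ_pi fun j => by
      split_ifs
      · exact measurableSet_singleton a
      · exact (measurableSet_singleton a).compl
  have hA : ∀ S ∈ Finset.powersetCard k (Finset.univ : Finset ι),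
      (Measure.pi fun _ : ι => ν).real (A S) =
        ν.real {a} ^ k * (1 - ν.real {a}) ^ (Fintype.card ι - k) := by
    intro S hS
    rw [Finset.mem_powersetCard] at hS
    have : ∀ j, (ν (if j ∈ S then {a} else {a}ᶜ)).toReal =
        if j ∈ S then ν.real {a} else 1 - ν.real {a} := by
      intro j
      split_ifs
      · rfl
      · exact probReal_compl_eq_one_sub (measurableSet_singleton a)
    rw [measureReal_def, Measure.pi_pi, ENNReal.toReal_prod, Finset.prod_congr rfl fun j _ => this j,
      Finset.prod_ite, Finset.prod_const, Finset.prod_const]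
    simp only [Finset.filter_mem_eq_inter, Finset.univ_inter, hS.2]
    congr 2
    rw [Finset.filter_not, Finset.filter_mem_eq_inter, Finset.univ_inter,
      ← Finset.compl_eq_univ_sdiff, Finset.card_compl, hS.2]
  rw [hU, measureReal_biUnion_finset, Finset.sum_congr rfl hA]
  · simp [mul_assoc]
  · intro S _ T _ hST
    refine Set.disjoint_left.2 fun x hx hx' => hST ?_
    rw [← (memA S x).1 hx, (memA T x).1 hx']
  · exact fun S _ => hmeas S

/-! ### Bounded differences -/

/-- **McDiarmid's inequality** for functions on a finite power of a finite space: a function with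
bounded differences is sub-Gaussian. -/
theorem ProbabilityTheory.hasSubgaussianMGF_of_bounded_differences {α : Type*} [Finite α]
    [MeasurableSpace α] [MeasurableSingletonClass α] (ν : Measure α) [IsProbabilityMeasure ν]
    {n : ℕ} (f : (Fin n → α) → ℝ) (c : Fin n → NNReal)
    (hf : ∀ x i a, f (Function.update x i a) ≤ f x + c i) :
    HasSubgaussianMGF (fun x => f x - ∫ y, f y ∂(Measure.pi fun _ => ν))
      (∑ i, (c i / 2) ^ 2) (Measure.pi fun _ => ν) := by
  refine ⟨fun t => Integrable.of_finite, fun t => ?_⟩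
  induction n with
  | zero =>
    have h : ∀ x, f x = f default := fun x => congrArg f (Subsingleton.elim _ _)
    simp [mgf, h]
  | succ n ih =>
    have mp := (measurePreserving_piFinSuccAbove (fun _ : Fin (n + 1) => ν) 0).symm
    have hint : ∀ F : (Fin (n + 1) → α) → ℝ, ∫ x, F x ∂(Measure.pi fun _ => ν) =
        ∫ y, ∫ a, F (Fin.cons a y) ∂ν ∂(Measure.pi fun _ : Fin n => ν) := by
      intro F
      rw [← mp.integral_comp' F, integral_prod_symm _ Integrable.of_finite]
      simp [MeasurableEquiv.piFinSuccAbove, Fin.insertNthEquiv]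
    -- Averaging out coordinate 0 preserves the remaining bounded differences, so the induction
    -- applies to `g`; Hoeffding's lemma handles the fluctuation of `f` around `g`.
    set g : (Fin n → α) → ℝ := fun y => ∫ a, f (Fin.cons a y) ∂ν with hg
    have hgd : ∀ y i a, g (Function.update y i a) ≤ g y + c i.succ := by
      intro y i a
      calc g (Function.update y i a) ≤ ∫ b, (f (Fin.cons b y) + c i.succ) ∂ν :=
            integral_mono Integrable.of_finite Integrable.of_finite fun b => by
              simp only [Fin.cons_update]
              exact hf _ _ _
        _ = g y + c i.succ := by
            rw [integral_add Integrable.of_finite Integrable.of_finite]; simp [hg]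
    have hstep : ∀ y, ∫ a, Real.exp (t * (f (Fin.cons a y) - g y)) ∂ν ≤
        Real.exp (((c 0 / 2) ^ 2 : NNReal) * t ^ 2 / 2) := by
      intro y
      have : Nonempty α := nonempty_of_isProbabilityMeasure ν
      -- Starting from a minimiser, the one-sided hypothesis confines `f` to an interval of length
      -- `c 0`.
      obtain ⟨a₀, ha₀⟩ := Finite.exists_min fun a => f (Fin.cons a y)
      have := (hasSubgaussianMGF_of_mem_Icc (μ := ν) (X := fun a => f (Fin.cons a y))
        (a := f (Fin.cons a₀ y)) (b := f (Fin.cons a₀ y) + c 0) (measurable_of_finite _).aemeasurable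
        (.of_forall fun a => ⟨ha₀ a, by
          have := hf (Fin.cons a₀ y) 0 a
          rwa [Fin.update_cons_zero] at this⟩)).mgf_le t
      simpa [mgf] using this
    have hE : ∫ x, f x ∂(Measure.pi fun _ => ν) = ∫ y, g y ∂(Measure.pi fun _ : Fin n => ν) :=
      hint f
    rw [hE, mgf, hint]
    set e := ∫ y, g y ∂(Measure.pi fun _ : Fin n => ν)
    calc ∫ y, ∫ a, Real.exp (t * (f (Fin.cons a y) - e)) ∂ν ∂(Measure.pi fun _ : Fin n => ν)
        = ∫ y, Real.exp (t * (g y - e)) * (∫ a, Real.exp (t * (f (Fin.cons a y) - g y)) ∂ν)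
            ∂(Measure.pi fun _ : Fin n => ν) := by
          congr 1 with y
          rw [← integral_const_mul]
          congr 1 with a
          rw [← Real.exp_add]
          ring_nf
      _ ≤ ∫ y, Real.exp (t * (g y - e)) * Real.exp (((c 0 / 2) ^ 2 : NNReal) * t ^ 2 / 2)
            ∂(Measure.pi fun _ : Fin n => ν) :=
          integral_mono Integrable.of_finite Integrable.of_finite fun y =>
            mul_le_mul_of_nonneg_left (hstep y) (Real.exp_pos _).le
      _ = mgf (fun y => g y - e) (Measure.pi fun _ : Fin n => ν) t *
            Real.exp (((c 0 / 2) ^ 2 : NNReal) * t ^ 2 / 2) := integral_mul_const _ _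
      _ ≤ Real.exp ((∑ i : Fin n, (c i.succ / 2) ^ 2 : NNReal) * t ^ 2 / 2) *
            Real.exp (((c 0 / 2) ^ 2 : NNReal) * t ^ 2 / 2) :=
          mul_le_mul_of_nonneg_right (ih g (fun i => c i.succ) hgd) (Real.exp_pos _).le
      _ = _ := by
          rw [← Real.exp_add, Fin.sum_univ_succ]
          congr 1
          push_cast
          ring

/-! ### Stirling bounds for the central binomial weight -/

theorem Stirling.choose_mul_pow_mul_pow {k l : ℕ} (hk : k ≠ 0) (hl : l ≠ 0) :
    ((k + l).choose k : ℝ) * ((k : ℝ) / (k + l)) ^ k * ((l : ℝ) / (k + l)) ^ l =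
      stirlingSeq (k + l) / (stirlingSeq k * stirlingSeq l) * √((k + l) / (2 * k * l)) := by
  have hk' : (0 : ℝ) < k := by positivity
  have hl' : (0 : ℝ) < l := by positivity
  have hs : √(((k : ℝ) + l) / (2 * k * l)) = √(2 * (k + l)) / (√(2 * k) * √(2 * l)) := by
    rw [← Real.sqrt_mul (by positivity), ← Real.sqrt_div (by positivity)]
    congr 1
    field_simp
  rw [Nat.cast_choose ℝ (Nat.le_add_right k l), Nat.add_sub_cancel_left, hs]
  simp only [stirlingSeq, div_pow, pow_add, Nat.cast_add]
  have : √(2 * ((k : ℝ) + l)) ≠ 0 := by positivity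
  have : √(2 * (k : ℝ)) ≠ 0 := by positivity
  have : √(2 * (l : ℝ)) ≠ 0 := by positivity
  field_simp

theorem Stirling.stirlingSeq_pos {n : ℕ} (hn : n ≠ 0) : 0 < stirlingSeq n := by
  obtain ⟨i, rfl⟩ := Nat.exists_eq_succ_of_ne_zero hn
  exact stirlingSeq'_pos i

/-- Index 0 must be excluded: `stirlingSeq 0 = 0` by division by zero. -/
theorem Stirling.stirlingSeq_anti {m n : ℕ} (hm : m ≠ 0) (hmn : m ≤ n) :
    stirlingSeq n ≤ stirlingSeq m := by
  obtain ⟨i, rfl⟩ := Nat.exists_eq_succ_of_ne_zero hm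
  obtain ⟨j, rfl⟩ := Nat.exists_eq_succ_of_ne_zero (show n ≠ 0 by omega)
  exact stirlingSeq'_antitone (Nat.succ_le_succ_iff.1 hmn)

theorem Stirling.stirlingSeq_sq_le {n : ℕ} (hn : n ≠ 0) :
    stirlingSeq n ^ 2 ≤ Real.exp 1 ^ 2 / 2 :=
  calc stirlingSeq n ^ 2 ≤ stirlingSeq 1 ^ 2 :=
        pow_le_pow_left₀ (stirlingSeq_pos hn).le
          (stirlingSeq_anti one_ne_zero (Nat.one_le_iff_ne_zero.2 hn)) 2
    _ = _ := by rw [stirlingSeq_one, div_pow, Real.sq_sqrt (by norm_num)]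

theorem Stirling.pi_le_stirlingSeq_sq {n : ℕ} (hn : n ≠ 0) : Real.pi ≤ stirlingSeq n ^ 2 :=
  (Real.sqrt_le_left (stirlingSeq_pos hn).le).1 (sqrt_pi_le_stirlingSeq hn)

section

open Stirling

variable {n k : ℕ} {p : unitInterval}

theorem ProbabilityTheory.one_sub_mul_binomial_real_sq (hk : k ≠ 0) (hkn : k < n)
    (h : (n : ℝ) * p = k) :
    (1 - p) * (binomial n p).real {k} ^ 2 =
      stirlingSeq n ^ 2 / (stirlingSeq k ^ 2 * stirlingSeq (n - k) ^ 2) * (1 / (2 * k)) := by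
  obtain ⟨l, rfl⟩ := Nat.exists_eq_add_of_le hkn.le
  have hl : l ≠ 0 := by omega
  have hk' : (0 : ℝ) < k := by positivity
  have hl' : (0 : ℝ) < l := by positivity
  push_cast at h
  have hp : (p : ℝ) = k / (k + l) := by
    rw [eq_div_iff (by positivity), mul_comm]
    exact h
  have hq : 1 - (p : ℝ) = l / (k + l) := by
    rw [hp]
    field_simp
    ring
  rw [binomial_real_singleton, hq, hp, Nat.add_sub_cancel_left, choose_mul_pow_mul_pow hk hl,
    mul_pow, Real.sq_sqrt (by positivity), div_pow, mul_pow]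
  have := stirlingSeq_pos hk
  have := stirlingSeq_pos hl
  field_simp

theorem ProbabilityTheory.one_sub_mul_binomial_real_sq_le (hk : k ≠ 0) (hkn : k < n)
    (h : (n : ℝ) * p = k) :
    (1 - p) * (binomial n p).real {k} ^ 2 ≤ 1 / (2 * Real.pi * k) := by
  rw [one_sub_mul_binomial_real_sq hk hkn h]
  have hl : n - k ≠ 0 := by omega
  have := stirlingSeq_pos hk
  have := stirlingSeq_pos hl
  have hn := (stirlingSeq_pos (show n ≠ 0 by omega)).le
  have hk' : (0 : ℝ) < k := by positivity
  calc stirlingSeq n ^ 2 / (stirlingSeq k ^ 2 * stirlingSeq (n - k) ^ 2) * (1 / (2 * k))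
      ≤ stirlingSeq (n - k) ^ 2 / (Real.pi * stirlingSeq (n - k) ^ 2) * (1 / (2 * k)) := by
        gcongr
        · exact stirlingSeq_anti hl (Nat.sub_le n k)
        · exact pi_le_stirlingSeq_sq hk
    _ = 1 / (2 * Real.pi * k) := by
        field_simp

theorem ProbabilityTheory.le_one_sub_mul_binomial_real_sq (hk : k ≠ 0) (hkn : k < n)
    (h : (n : ℝ) * p = k) :
    1 / (4 * Real.pi * k) ≤ (1 - p) * (binomial n p).real {k} ^ 2 := by
  rw [one_sub_mul_binomial_real_sq hk hkn h]
  have hl : n - k ≠ 0 := by omega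
  have := stirlingSeq_pos hk
  have := stirlingSeq_pos hl
  have hk' : (0 : ℝ) < k := by positivity
  have he : Real.exp 1 ^ 2 ≤ 7.4 := by
    nlinarith [Real.exp_one_lt_d9, Real.exp_pos 1]
  have hpi := Real.pi_gt_d2
  -- Here 3.7 bounds `stirlingSeq 1 ^ 2 = e² / 2`, and `3.7² ≤ 2π²`.
  calc 1 / (4 * Real.pi * k) ≤ Real.pi / (3.7 * 3.7) * (1 / (2 * k)) := by
        rw [div_mul_div_comm, div_le_div_iff₀ (by positivity) (by positivity)]
        nlinarith [mul_le_mul hpi.le hpi.le (by norm_num) (by positivity)]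
    _ ≤ stirlingSeq n ^ 2 / (stirlingSeq k ^ 2 * stirlingSeq (n - k) ^ 2) * (1 / (2 * k)) := by
        gcongr
        · exact pi_le_stirlingSeq_sq (by omega)
        · linarith [stirlingSeq_sq_le hk]
        · linarith [stirlingSeq_sq_le hl]

end

/-! ### Expectation and concentration of the number of forwarded balls -/

namespace BallsIntoBins

variable {n m : ℕ}

theorem numForwarded_update_le (k : ℕ) (x : Fin n → Fin m) (j : Fin n) (a : Fin m) :
    numForwarded k (Function.update x j a) ≤ numForwarded k x + 1 := by
  -- Only the bin receiving the moved ball can gain, and it gains at most one.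
  have hB : ∀ b, ballCount (Function.update x j a) b ≤ ballCount x b + if a = b then 1 else 0 := by
    intro b
    split_ifs with hab
    · refine le_trans (Finset.card_le_card (t := insert j (Finset.univ.filter fun i => x i = b))
        fun i hi => ?_) (Finset.card_insert_le _ _)
      by_cases hij : i = j <;> simp_all
    · rw [add_zero]
      refine Finset.card_le_card fun i hi => ?_
      by_cases hij : i = j <;> simp_all
  rw [numForwarded_eq_sum, numForwarded_eq_sum]
  calc ∑ b, (ballCount (Function.update x j a) b - k)
      ≤ ∑ b, ((ballCount x b - k) + if a = b then 1 else 0) :=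
        Finset.sum_le_sum fun b _ => by have := hB b; omega
    _ = _ := by simp [Finset.sum_add_distrib]

theorem map_ballCount (ν : Measure (Fin m)) [IsProbabilityMeasure ν] (i : Fin m)
    (p : unitInterval) (hp : ν.real {i} = p) :
    (Measure.pi fun _ : Fin n => ν).map (fun x => ballCount x i) = binomial n p := by
  have := Measure.isProbabilityMeasure_map (μ := Measure.pi fun _ : Fin n => ν)
    (f := fun x => ballCount x i) (measurable_of_finite _).aemeasurable
  refine Measure.ext_of_measureReal_singleton fun k => ?_
  rw [map_measureReal_apply (measurable_of_finite _) (measurableSet_singleton k),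
    binomial_real_singleton, ← hp]
  have := Measure.pi_real_card_filter_eq (ι := Fin n) ν i k
  rwa [Fintype.card_fin] at this

theorem uniformOn_univ_real_singleton (i : Fin m) :
    (uniformOn (Set.univ : Set (Fin m))).real {i} = 1 / m := by
  simp [measureReal_def, uniformOn_univ]

theorem integral_numForwarded [NeZero m] (k : ℕ) (p : unitInterval) (hp : (p : ℝ) = 1 / m)
    (hn : n = m * k) :
    ∫ x, (numForwarded k x : ℝ) ∂(Measure.pi fun _ : Fin n => uniformOn (Set.univ : Set (Fin m))) =
      n * (1 - p) * (binomial n p).real {k} := by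
  have hm : (m : ℝ) ≠ 0 := NeZero.ne _
  have hnp : (n : ℝ) * p = k := by
    rw [hp, hn]
    push_cast
    field_simp
  have hi : ∀ i : Fin m, ∫ x, ((ballCount x i - k : ℕ) : ℝ)
      ∂(Measure.pi fun _ : Fin n => uniformOn (Set.univ : Set (Fin m))) =
      k * (1 - p) * (binomial n p).real {k} := by
    intro i
    rw [← integral_tsub_binomial n k p hnp,
      ← map_ballCount _ i p ((uniformOn_univ_real_singleton i).trans hp.symm),
      integral_map (measurable_of_finite _).aemeasurable
        (measurable_of_countable _).aestronglyMeasurable]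
  simp only [numForwarded_eq_sum, Nat.cast_sum]
  rw [integral_finsetSum _ fun i _ => Integrable.of_finite, Finset.sum_congr rfl fun i _ => hi i]
  simp [hn]
  ring

theorem hasSubgaussianMGF_numForwarded [NeZero m] (k : ℕ) :
    HasSubgaussianMGF
      (fun x : Fin n → Fin m => (numForwarded k x : ℝ) -
        ∫ y, (numForwarded k y : ℝ) ∂(Measure.pi fun _ : Fin n => uniformOn (Set.univ : Set (Fin m))))
      (n / 4) (Measure.pi fun _ => uniformOn (Set.univ : Set (Fin m))) := by
  have := hasSubgaussianMGF_of_bounded_differences (uniformOn (Set.univ : Set (Fin m)))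
    (fun x : Fin n → Fin m => (numForwarded k x : ℝ)) (fun _ => 1)
    fun x i a => by exact_mod_cast numForwarded_update_le k x i a
  convert this using 1
  simp
  norm_num [div_eq_mul_inv]

/-- The tail bound that McDiarmid's inequality gives, in terms of the expectation
`n * (1 - p) * b`. -/
theorem exp_mcdiarmid_le {N k b q δ : ℝ} (hN : 0 < N) (hk : 20 ≤ k) (hq : 4 / 5 ≤ q) (hδ : 0 < δ)
    (hb : 1 / (4 * Real.pi * k) ≤ q * b ^ 2) :
    Real.exp (-(δ * (N * q * b)) ^ 2 / (2 * (N / 4))) ≤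
      min (2 * Real.pi * k / (δ ^ 2 * 0.99 * N))
        (Real.exp (-(δ ^ 2 * (N / k) * 0.99 * q) / (Real.pi * k))) := by
  have hpi := Real.pi_pos
  have hx : δ ^ 2 * N * q / (2 * Real.pi * k) ≤ (δ * (N * q * b)) ^ 2 / (2 * (N / 4)) := by
    calc δ ^ 2 * N * q / (2 * Real.pi * k)
        = 2 * δ ^ 2 * N * q * (1 / (4 * Real.pi * k)) := by field_simp; ring
      _ ≤ 2 * δ ^ 2 * N * q * (q * b ^ 2) := by gcongr
      _ = _ := by field_simp; ring
  set x := δ ^ 2 * N * q / (2 * Real.pi * k) with hxdef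
  have hx0 : 0 < x := by positivity
  have hexp : Real.exp (-(δ * (N * q * b)) ^ 2 / (2 * (N / 4))) ≤ Real.exp (-x) := by
    rw [neg_div]
    gcongr
  refine hexp.trans (le_min ?_ ?_)
  -- From `exp x ≥ e * x` and `e > 2`; the polynomial bound then only needs `q ≥ 0.99 / 2`.
  · have h2 : 2 * x ≤ Real.exp x := by
      have h1 := Real.add_one_le_exp (x - 1)
      rw [Real.exp_sub, le_div_iff₀ (Real.exp_pos 1)] at h1
      nlinarith [Real.exp_one_gt_d9]
    calc Real.exp (-x) ≤ (2 * x)⁻¹ := by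
          rw [Real.exp_neg]
          gcongr
      _ = Real.pi * k / (δ ^ 2 * q * N) := by
          rw [hxdef]
          field_simp
      _ ≤ Real.pi * k / (δ ^ 2 * (0.99 / 2) * N) := by
          gcongr
          linarith
      _ = _ := by
          field_simp
  · rw [neg_div]
    gcongr
    -- After cancellation this amounts to `1.98 ≤ k`.
    rw [hxdef, div_le_div_iff₀ (by positivity) (by positivity)]
    have : δ ^ 2 * (N / k) * 0.99 * q * (2 * Real.pi * k) = δ ^ 2 * N * q * Real.pi * 1.98 := by
      field_simp
      ring
    rw [this]
    have : 0 < δ ^ 2 * N * q * Real.pi := by positivity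
    nlinarith

end BallsIntoBins

/-! ### Transfer to an arbitrary probability space -/

theorem theorem2 {Ω : Type*} [MeasurableSpace Ω] (μ : MeasureTheory.Measure Ω)
    [MeasureTheory.IsProbabilityMeasure μ]
    (n m k : ℕ) (hm : 0 < m) (hk : 0 < k) (hn : n = m * k)
    (p : unitInterval) (hp : (p : ℝ) = 1 / (m : ℝ))
    -- ball `j` is mapped to the random bin `h j`, independently and uniformly
    (h : Fin n → Ω → Fin m)
    (hindep : ProbabilityTheory.iIndepFun h μ)
    (hunif : ∀ j, ProbabilityTheory.HasLaw (h j) (ProbabilityTheory.uniformOn Set.univ) μ)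
    (X : Ω → ℝ)
    (hX : ∀ ω, X ω = (BallsIntoBins.numForwarded k (fun j => h j ω) : ℝ)) :
    MeasureTheory.Integrable X μ ∧
    (∫ ω, X ω ∂μ) = (n : ℝ) * (1 - p) * (ProbabilityTheory.binomial n p).real {k} ∧
    (n : ℝ) * (1 - p) * (ProbabilityTheory.binomial n p).real {k} ≤
      (n : ℝ) * (1 / Real.sqrt (2 * Real.pi * k)) ∧
    (5 * k ≤ n → 20 ≤ k → ∀ δ : ℝ, 0 < δ →
      μ.real {ω | (1 + δ) * (∫ ω', X ω' ∂μ) ≤ X ω} ≤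
        min (2 * Real.pi * (k : ℝ) / (δ ^ 2 * 0.99 * (n : ℝ)))
          (Real.exp (-(δ ^ 2 * (m : ℝ) * 0.99 * (1 - p)) / (Real.pi * (k : ℝ))))) := by
  have : NeZero m := ⟨hm.ne'⟩
  have hm' : (0 : ℝ) < m := by exact_mod_cast hm
  have hk' : (0 : ℝ) < k := by exact_mod_cast hk
  have hnp : (n : ℝ) * p = k := by
    rw [hp, hn]
    push_cast
    field_simp
  have hlaw := hindep.hasLaw_pi hunif
  have hXf : X = (fun x : Fin n → Fin m => (BallsIntoBins.numForwarded k x : ℝ)) ∘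
      fun ω i => h i ω := funext hX
  have hmeas : AEMeasurable (fun ω i => h i ω) μ := hlaw.aemeasurable
  have hE : ∫ ω, X ω ∂μ = n * (1 - p) * (binomial n p).real {k} := by
    rw [← BallsIntoBins.integral_numForwarded k p hp hn, ← hlaw.map_eq,
      integral_map hmeas (measurable_of_finite _).aestronglyMeasurable]
    simp only [hX]
  have hq0 : 0 ≤ 1 - (p : ℝ) := sub_nonneg.2 p.2.2
  have hlt : 1 < m → k < n := fun h1 => by
    rw [hn]
    exact lt_mul_left hk h1
  refine ⟨?_, hE, ?_, ?_⟩
  · rw [hXf]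
    refine Integrable.comp_aemeasurable ?_ hmeas
    rw [hlaw.map_eq]
    exact Integrable.of_finite
  · rw [mul_assoc]
    gcongr
    -- The Stirling bound needs `k < n`; for `m = 1` one has `p = 1` and the left side is zero.
    rcases Nat.lt_or_ge 1 m with h1 | h1
    · rw [one_div, ← Real.sqrt_inv, ← one_div]
      refine Real.le_sqrt_of_sq_le ?_
      have hb := one_sub_mul_binomial_real_sq_le hk.ne' (hlt h1) hnp
      have h0 : 0 ≤ (1 - (p : ℝ)) * (binomial n p).real {k} ^ 2 := by positivity
      calc ((1 - (p : ℝ)) * (binomial n p).real {k}) ^ 2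
          = (1 - p) * ((1 - p) * (binomial n p).real {k} ^ 2) := by ring
        _ ≤ (1 - p) * (binomial n p).real {k} ^ 2 :=
            mul_le_of_le_one_left h0 (by linarith [p.2.1])
        _ ≤ _ := hb
    · obtain rfl : m = 1 := by omega
      have : 1 - (p : ℝ) = 0 := by rw [hp]; simp
      rw [this, zero_mul]
      positivity
  · intro h5 h20 δ hδ
    have hm5 : 5 ≤ m := by
      rw [hn] at h5
      exact Nat.le_of_mul_le_mul_right h5 hk
    have hN : (0 : ℝ) < n := by
      rw [hn]
      push_cast
      positivity
    have hq : 4 / 5 ≤ 1 - (p : ℝ) := by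
      have : (1 : ℝ) / m ≤ 1 / 5 := by
        gcongr
        exact_mod_cast hm5
      rw [hp]
      linarith
    have hb := le_one_sub_mul_binomial_real_sq hk.ne' (hlt (by omega)) hnp
    have hsub := BallsIntoBins.hasSubgaussianMGF_numForwarded (n := n) (m := m) k
    rw [← hlaw.map_eq] at hsub
    have htail := (hsub.of_map hmeas).measure_ge_le
      (ε := δ * (n * (1 - p) * (binomial n p).real {k})) (by positivity)
    rw [hlaw.map_eq, BallsIntoBins.integral_numForwarded k p hp hn] at htail
    have hfin := BallsIntoBins.exp_mcdiarmid_le hN (by exact_mod_cast h20) hq hδ hb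
    have hNk : (n : ℝ) / k = m := by
      rw [hn]
      push_cast
      field_simp
    rw [hNk] at hfin
    refine le_trans (le_of_eq ?_) (htail.trans (le_trans (le_of_eq ?_) hfin))
    · congr 1
      ext ω
      rw [Set.mem_ofPred_eq, Set.mem_ofPred_eq, hE, hX, Function.comp_apply]
      constructor <;> intro hω <;> linarith
    · norm_num
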